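/- **Theorem 3.** Consider the two-player differentiable game $\mathcal N$ in which player 1 has parameter $x\in\mathbb R$, player 2 has parameter $y\in\mathbb R$, and, with $\theta=(x,y)$, the losses are $$L^1(x,y)=xy-\tfrac{x^2}{2}+\tfrac{y^2}{2}+\tfrac{x^4}{4}-\tfrac{y^4}{4}=-L^2(x,y).$$ Write $\xi=(\partial_xL^1,\partial_yL^2)^{T}$ for the simultaneous gradient, $H=\nabla\xi$ for its (in general non-symmetric) Jacobian, $A=\frac12(H-H^T)$ for the antisymmetric part and $H_o$ for the off-diagonal part of $H$, and $\chi=\operatorname{diag}(H_o^T\nabla L)$, where $\nabla L$ is the matrix with columns $\nabla L^1,\nabla L^2$. A critical point is a zero of $\xi$; it is a strict maximum if $u^TH u<0$ there for all $u\neq0$. (a) $\mathcal N$ is zero-sum; analytic; weakly coercive, i.e. $L^1(x,y)\to\infty$ as $|x|\to\infty$ for every fixed $y$ and $L^2(x,y)\to\infty$ as $|y|\to\infty$ for every fixed $x$; and nondegenerate, i.e. $H$ is invertible at every critical point. It has exactly one critical point, and this is a strict maximum. (b) Let $\mathcal A$ consist of the algorithms $\theta_{k+1}=\theta_k-\alpha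 G(\theta_k)$ with learning rate $\alpha>0$ and $G$ one of - GD: $\xi$; - AGD: $\big(\xi_1(x,y),\ \xi_2(x-\alpha\xi_1(x,y),\,y)\big)$; - EG: $\xi\circ(\mathrm{id}-\alpha\xi)$; - OMD: $2\xi(\theta_k)-\xi(\theta_{k-1})$ with $\theta_{-1}=\theta_0$, and also its memoryless form $2\xi-\xi\circ(\mathrm{id}-\alpha\xi)^{-1}$, where $(\mathrm{id}-\alpha\xi)^{-1}(\theta)$ is the limit of the proximal point iteration $\eta\mapsto\theta+\alpha\xi(\eta)$ started at $\theta$; - SGA: $(I+\lambda A^T)\xi$ with $\lambda=\operatorname{sign}\big(\langle\xi,H^T\xi\rangle\,\langle A^T\xi,H^T\xi\rangle\big)$, $\operatorname{sign}(0)=0$; - CO: $(I+\gamma H^T)\xi$, with a hyperparameter $\gamma>0$; - CGD: $(I+\alpha H_o)^{-1}\xi$; - LA: $(I-\alpha H_o)\xi$; - LOLA: $(I-\alpha H_o)\xi-\alpha\chi$; - SOS: $(I-\alpha H_o)\xi-p\,\alpha\,\chi$, where $p=p(\theta)$ is any function with values in $[0,1]$ (in particular the usual two-part criterion of SOS, which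 may depend on $\alpha$). For every bounded set $U\subset\mathbb R^2$ there is $\delta>0$ such that for all $\alpha,\gamma\in(0,\delta)$, every algorithm in $\mathcal A$ and every continuous (atomless; for example absolutely continuous) probability measure $\nu$ concentrated on $U$, the following holds for $\nu$-almost every initial point $\theta_0$: the iterates $(\theta_k)$ are well defined (the inverses that occur exist at every iterate), bounded, and not convergent. -/

import Mathlib

open Filter Topology MeasureTheory Matrix

noncomputable section

/-- A two-player differentiable game. The joint parameter vector lives in `κ → ℝ`, each coordinate
belongs to the player `owner k`, and `loss i` is the loss of player `i` (players are `0` and `1`).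
All notions below that involve size (boundedness, convergence, tending to infinity) do not depend
on the choice of a norm on `κ → ℝ`; inner products are written with `⬝ᵥ`. -/
structure TwoPlayerGame (κ : Type) [Fintype κ] [DecidableEq κ] where
  owner : κ → Fin 2
  loss : Fin 2 → (κ → ℝ) → ℝ
  contDiff_loss : ∀ i, ContDiff ℝ 2 (loss i)

namespace TwoPlayerGame

variable {κ : Type} [Fintype κ] [DecidableEq κ]

/-- The partial derivative of `f` in the coordinate `k`. -/
def pd (f : (κ → ℝ) → ℝ) (k : κ) (θ : κ → ℝ) : ℝ := fderiv ℝ f θ (Pi.single k 1)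

/-- The simultaneous gradient `ξ`: each player's gradient of that player's own loss. -/
def xi (G : TwoPlayerGame κ) (θ : κ → ℝ) : κ → ℝ := fun k => pd (G.loss (G.owner k)) k θ

/-- The game Hessian `H = ∇ξ`, with entries `∂_l ∂_k L^{owner k}`. -/
def hess (G : TwoPlayerGame κ) (θ : κ → ℝ) : Matrix κ κ ℝ :=
  Matrix.of fun k l => pd (pd (G.loss (G.owner k)) k) l θ

/-- The off-diagonal blocks `H_o` of the Hessian. -/
def hessOff (G : TwoPlayerGame κ) (θ : κ → ℝ) : Matrix κ κ ℝ :=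
  Matrix.of fun k l => if G.owner k = G.owner l then 0 else G.hess θ k l

/-- The antisymmetric part `A` of the Hessian. -/
def hessAnti (G : TwoPlayerGame κ) (θ : κ → ℝ) : Matrix κ κ ℝ :=
  (1 / 2 : ℝ) • (G.hess θ - (G.hess θ)ᵀ)

/-- The vector `diag (H_oᵀ ∇L)`, where `∇L` has the gradient of `L^i` as its `i`-th column; the
block of player `i` is read off the `i`-th column. -/
def chi (G : TwoPlayerGame κ) (θ : κ → ℝ) : κ → ℝ :=
  fun k => ∑ l, G.hessOff θ l k * pd (G.loss (G.owner k)) l θ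

/-- Critical points. -/
def IsCritical (G : TwoPlayerGame κ) (θ : κ → ℝ) : Prop := G.xi θ = 0

/-- Strict maxima: critical points whose (not necessarily symmetric) Hessian is negative
definite. -/
def IsStrictMax (G : TwoPlayerGame κ) (θ : κ → ℝ) : Prop :=
  G.IsCritical θ ∧ ∀ u : κ → ℝ, u ≠ 0 → u ⬝ᵥ (G.hess θ *ᵥ u) < 0

/-- The Hessian is invertible at every critical point. -/
def Nondegenerate (G : TwoPlayerGame κ) : Prop :=
  ∀ θ, G.IsCritical θ → IsUnit (G.hess θ)

def ZeroSum (G : TwoPlayerGame κ) : Prop := ∀ θ, G.loss 0 θ + G.loss 1 θ = 0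

def Analytic (G : TwoPlayerGame κ) : Prop := ∀ i, AnalyticOnNhd ℝ (G.loss i) Set.univ

/-- Each player's loss tends to infinity when that player's parameters tend to infinity while the
parameters of the other player stay fixed. -/
def WeaklyCoercive (G : TwoPlayerGame κ) : Prop :=
  ∀ (i : Fin 2) (θ : κ → ℝ),
    Tendsto (G.loss i) (cocompact (κ → ℝ) ⊓ 𝓟 {η | ∀ k, G.owner k ≠ i → η k = θ k}) atTop

/-- The proximal point iteration `η ↦ θ + α ξ(η)`, started at `θ`. -/
def prox (G : TwoPlayerGame κ) (α : ℝ) (θ : κ → ℝ) (m : ℕ) : κ → ℝ :=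
  (fun η => θ + α • G.xi η)^[m] θ

/-- `(id - α ξ)⁻¹ θ`, computed as the limit of the proximal point iteration. -/
def proxInv (G : TwoPlayerGame κ) (α : ℝ) (θ : κ → ℝ) : κ → ℝ :=
  limUnder atTop (G.prox α θ)

end TwoPlayerGame

/-- The algorithms. `omd` is optimistic mirror descent with its memory of the previous iterate,
`omdProx` is its memoryless form. `sos` comes with an arbitrary weight function `p`
with values in `[0, 1]`; see `Algorithm.sosTwoPart` for the usual one. -/
inductive Algorithm (κ : Type) : Type
  | gd | agd | eg | omd | omdProx | sga | co | cgd | la | lola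
  | sos (p : (κ → ℝ) → ℝ) (hp : ∀ θ, p θ ∈ Set.Icc (0 : ℝ) 1)

namespace Algorithm

variable {κ : Type} [Fintype κ] [DecidableEq κ]

/-- The update direction: the next iterate is `cur - α • direction prev cur`. Only `omd` makes use
of the previous iterate `prev`, and only `co` of the hyperparameter `γ`. -/
def direction (G : TwoPlayerGame κ) (α γ : ℝ) :
    Algorithm κ → (κ → ℝ) → (κ → ℝ) → (κ → ℝ)
  | gd, _, θ => G.xi θ
  | agd, _, θ => fun k =>
      if G.owner k = 0 then G.xi θ k
      else G.xi (fun l => if G.owner l = 0 then θ l - α * G.xi θ l else θ l) k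
  | eg, _, θ => G.xi (θ - α • G.xi θ)
  | omd, prev, θ => (2 : ℝ) • G.xi θ - G.xi prev
  | omdProx, _, θ => (2 : ℝ) • G.xi θ - G.xi (G.proxInv α θ)
  | sga, _, θ =>
      (1 + Real.sign ((G.xi θ ⬝ᵥ ((G.hess θ)ᵀ *ᵥ G.xi θ)) *
          (((G.hessAnti θ)ᵀ *ᵥ G.xi θ) ⬝ᵥ ((G.hess θ)ᵀ *ᵥ G.xi θ))) •
        (G.hessAnti θ)ᵀ) *ᵥ G.xi θ
  | co, _, θ => (1 + γ • (G.hess θ)ᵀ) *ᵥ G.xi θ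
  | cgd, _, θ => (1 + α • G.hessOff θ)⁻¹ *ᵥ G.xi θ
  | la, _, θ => (1 - α • G.hessOff θ) *ᵥ G.xi θ
  | lola, _, θ => (1 - α • G.hessOff θ) *ᵥ G.xi θ - α • G.chi θ
  | sos p _, _, θ => (1 - α • G.hessOff θ) *ᵥ G.xi θ - (p θ * α) • G.chi θ

/-- The inverses that occur in the update direction at `θ` exist: for `cgd` the matrix
`I + α H_o` is invertible, for `omdProx` the proximal point iteration converges (and then, as `ξ`
is continuous, to a solution `η` of `η - α ξ(η) = θ`). -/
def StepDefined (G : TwoPlayerGame κ) (α : ℝ) : Algorithm κ → (κ → ℝ) → Prop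
  | omdProx, θ => ∃ η, Tendsto (G.prox α θ) atTop (𝓝 η)
  | cgd, θ => IsUnit (1 + α • G.hessOff θ)
  | _, _ => True

/-- The iterates from `θ₀`; the iterate before `θ₀`, needed by `omd` only, is `θ₀` itself. -/
def iterates (G : TwoPlayerGame κ) (α γ : ℝ) (F : Algorithm κ) (θ₀ : κ → ℝ) : ℕ → (κ → ℝ)
  | 0 => θ₀
  | 1 => θ₀ - α • F.direction G α γ θ₀ θ₀
  | k + 2 => iterates G α γ F θ₀ (k + 1) -
      α • F.direction G α γ (iterates G α γ F θ₀ k) (iterates G α γ F θ₀ (k + 1))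

/-- The usual two-part weight of `sos`, with hyperparameters `a, b` (in `(0, 1)`). -/
def sosWeight (G : TwoPlayerGame κ) (α a b : ℝ) (θ : κ → ℝ) : ℝ :=
  let ξ₀ := (1 - α • G.hessOff θ) *ᵥ G.xi θ
  let t := ((-α) • G.chi θ) ⬝ᵥ ξ₀
  min (if 0 ≤ t then 1 else min 1 (-a * (ξ₀ ⬝ᵥ ξ₀) / t))
    (if G.xi θ ⬝ᵥ G.xi θ < b ^ 2 then G.xi θ ⬝ᵥ G.xi θ else 1)

theorem sosWeight_mem (G : TwoPlayerGame κ) (α a b : ℝ) (ha : a ∈ Set.Ioo (0 : ℝ) 1)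
    (θ : κ → ℝ) : sosWeight G α a b θ ∈ Set.Icc (0 : ℝ) 1 := by
  have nn : ∀ v : κ → ℝ, 0 ≤ v ⬝ᵥ v := fun v =>
    Finset.sum_nonneg fun i _ => mul_self_nonneg (v i)
  refine ⟨le_min ?_ ?_, (min_le_left _ _).trans ?_⟩
  · split_ifs with h
    · exact zero_le_one
    · refine le_min zero_le_one (div_nonneg_of_nonpos ?_ (not_le.mp h).le)
      have := mul_nonneg ha.1.le (nn ((1 - α • G.hessOff θ) *ᵥ G.xi θ))
      linarith
  · split_ifs
    · exact nn _
    · exact zero_le_one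
  · split_ifs
    · exact le_rfl
    · exact min_le_left _ _

/-- Stable opponent shaping with the usual two-part weight. -/
def sosTwoPart (G : TwoPlayerGame κ) (α a b : ℝ) (ha : a ∈ Set.Ioo (0 : ℝ) 1) :
    Algorithm κ :=
  sos (sosWeight G α a b) (sosWeight_mem G α a b ha)

end Algorithm

/-- The zero-sum game `L¹ = xy - x²/2 + y²/2 + x⁴/4 - y⁴/4 = -L²`, with `x = θ 0` the parameter of
the first player and `y = θ 1` the parameter of the second. -/
def gameN : TwoPlayerGame (Fin 2) where
  owner := id
  loss := ![
    fun θ => θ 0 * θ 1 - θ 0 ^ 2 / 2 + θ 1 ^ 2 / 2 + θ 0 ^ 4 / 4 - θ 1 ^ 4 / 4,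
    fun θ => -(θ 0 * θ 1 - θ 0 ^ 2 / 2 + θ 1 ^ 2 / 2 + θ 0 ^ 4 / 4 - θ 1 ^ 4 / 4)]
  contDiff_loss := by
    intro i
    fin_cases i <;> simp <;> fun_prop

end

noncomputable section

namespace TwoPlayerGame

/-! With `r = x² + y²` one has `⟨θ, ξ⟩ = x⁴ + y⁴ - r`: the bilinear term only rotates, so `-ξ`
points outwards near the origin and inwards far away. The origin is the only critical point.

For small rates, every algorithm moves along `ξ + l Aᵀ ξ` up to a small relative error, with `|l| ≤
1`, and with `l ≤ 0` when `r ≤ 1/3` (`PlaneStep`, `nearXi_direction`). Since `⟨θ, Aᵀ ξ⟩ = r + xy(x²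
- y²)` is nonnegative near the origin, such an `l` only adds to the repulsion, and far away the
quartic dominates it.

Hence a large disc is invariant (`PlaneStep.sq_le`), `r` does not decrease while `r ≤ 1/3`
(`PlaneStep.sq_le_sq_of_le`), and no step lands on the origin (`PlaneStep.sq_pos`). Displacements
control `ξ` (`PlaneStep.sq_xi_le_sq_sub`), so a limit would be critical, hence the origin, against
the repulsion. Only the start at the origin is excluded, a null set for `ν`. No regularity of the
update maps is needed, so the sign in SGA and the weight in SOS may jump. -/

theorem pd_eq_of_hasFDerivAt {κ : Type} [Fintype κ] [DecidableEq κ] {f : (κ → ℝ) → ℝ}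
    {f' : (κ → ℝ) →L[ℝ] ℝ} {θ : κ → ℝ} (h : HasFDerivAt f f' θ) (k : κ) :
    pd f k θ = f' (Pi.single k 1) := by
  rw [pd, h.fderiv]

end TwoPlayerGame

/-! ### Gradients and Hessian of the game -/

namespace gameN

open TwoPlayerGame

theorem hasFDerivAt_coord (i : Fin 2) (θ : Fin 2 → ℝ) :
    HasFDerivAt (fun η : Fin 2 → ℝ => η i)
      (ContinuousLinearMap.proj i : (Fin 2 → ℝ) →L[ℝ] ℝ) θ :=
  hasFDerivAt_apply i θ

theorem loss_zero : gameN.loss 0 = fun θ : Fin 2 → ℝ =>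
    θ 0 * θ 1 - θ 0 ^ 2 / 2 + θ 1 ^ 2 / 2 + θ 0 ^ 4 / 4 - θ 1 ^ 4 / 4 := rfl

theorem loss_one : gameN.loss 1 = fun θ : Fin 2 → ℝ =>
    -(θ 0 * θ 1 - θ 0 ^ 2 / 2 + θ 1 ^ 2 / 2 + θ 0 ^ 4 / 4 - θ 1 ^ 4 / 4) := rfl

@[simp] theorem owner_eq (k : Fin 2) : gameN.owner k = k := rfl

theorem hasFDerivAt_loss_zero (θ : Fin 2 → ℝ) :
    HasFDerivAt (gameN.loss 0)
      ((θ 1 - θ 0 + θ 0 ^ 3) • (ContinuousLinearMap.proj 0 : (Fin 2 → ℝ) →L[ℝ] ℝ) +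
        (θ 0 + θ 1 - θ 1 ^ 3) • (ContinuousLinearMap.proj 1 : (Fin 2 → ℝ) →L[ℝ] ℝ)) θ := by
  have h0 := hasFDerivAt_coord 0 θ
  have h1 := hasFDerivAt_coord 1 θ
  have h := ((((h0.mul h1).sub ((h0.pow 2).mul_const 2⁻¹)).add ((h1.pow 2).mul_const 2⁻¹)).add
    ((h0.pow 4).mul_const 4⁻¹)).sub ((h1.pow 4).mul_const 4⁻¹)
  simp only [loss_zero, div_eq_mul_inv]
  refine h.congr_fderiv ?_
  ext v
  simp
  ring

theorem hasFDerivAt_loss_one (θ : Fin 2 → ℝ) :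
    HasFDerivAt (gameN.loss 1)
      (-((θ 1 - θ 0 + θ 0 ^ 3) • (ContinuousLinearMap.proj 0 : (Fin 2 → ℝ) →L[ℝ] ℝ) +
        (θ 0 + θ 1 - θ 1 ^ 3) • (ContinuousLinearMap.proj 1 : (Fin 2 → ℝ) →L[ℝ] ℝ))) θ :=
  (hasFDerivAt_loss_zero θ).neg

theorem pd_loss_zero_zero :
    pd (gameN.loss 0) 0 = fun θ : Fin 2 → ℝ => θ 1 - θ 0 + θ 0 ^ 3 := by
  funext θ
  simp [pd_eq_of_hasFDerivAt (hasFDerivAt_loss_zero θ)]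

theorem pd_loss_zero_one :
    pd (gameN.loss 0) 1 = fun θ : Fin 2 → ℝ => θ 0 + θ 1 - θ 1 ^ 3 := by
  funext θ
  simp [pd_eq_of_hasFDerivAt (hasFDerivAt_loss_zero θ)]

theorem pd_loss_one_zero :
    pd (gameN.loss 1) 0 = fun θ : Fin 2 → ℝ => -(θ 1 - θ 0 + θ 0 ^ 3) := by
  funext θ
  simp [pd_eq_of_hasFDerivAt (hasFDerivAt_loss_one θ)]

theorem pd_loss_one_one :
    pd (gameN.loss 1) 1 = fun θ : Fin 2 → ℝ => -θ 0 - θ 1 + θ 1 ^ 3 := by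
  funext θ
  simp [pd_eq_of_hasFDerivAt (hasFDerivAt_loss_one θ)]
  ring

theorem xi_zero (θ : Fin 2 → ℝ) : gameN.xi θ 0 = θ 1 - θ 0 + θ 0 ^ 3 :=
  congrFun pd_loss_zero_zero θ

theorem xi_one (θ : Fin 2 → ℝ) : gameN.xi θ 1 = -θ 0 - θ 1 + θ 1 ^ 3 :=
  congrFun pd_loss_one_one θ

theorem hess_eq (θ : Fin 2 → ℝ) :
    gameN.hess θ = !![-1 + 3 * θ 0 ^ 2, 1; -1, -1 + 3 * θ 1 ^ 2] := by
  have h0 := hasFDerivAt_coord 0 θ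
  have h1 := hasFDerivAt_coord 1 θ
  have e0 := pd_eq_of_hasFDerivAt ((h1.sub h0).add (h0.pow 3))
  have e1 := pd_eq_of_hasFDerivAt ((h0.neg.sub h1).add (h1.pow 3))
  ext k l
  fin_cases k
  · refine (congrArg (fun f => pd f l θ) pd_loss_zero_zero).trans ((e0 l).trans ?_)
    fin_cases l <;> simp
  · refine (congrArg (fun f => pd f l θ) pd_loss_one_one).trans ((e1 l).trans ?_)
    fin_cases l <;> simp

theorem hessOff_eq (θ : Fin 2 → ℝ) : gameN.hessOff θ = !![0, 1; -1, 0] := by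
  ext k l
  fin_cases k <;> fin_cases l <;> simp [hessOff, hess_eq]

theorem hessAnti_eq (θ : Fin 2 → ℝ) : gameN.hessAnti θ = !![0, 1; -1, 0] := by
  ext k l
  fin_cases k <;> fin_cases l <;> simp [hessAnti, hess_eq] <;> norm_num

theorem chi_eq (θ : Fin 2 → ℝ) : gameN.chi θ = ![gameN.xi θ 1, -gameN.xi θ 0] := by
  ext k
  fin_cases k
  · simp [chi, hessOff_eq, pd_loss_zero_one, xi_one]
    ring
  · simp [chi, hessOff_eq, pd_loss_one_zero, xi_zero]

/-- The combination `(x + y) ξ₁ + (y - x) ξ₂` cancels all quadratic terms and leaves a positive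
definite quartic form. -/
theorem eq_zero_of_isCritical {θ : Fin 2 → ℝ} (h : gameN.IsCritical θ) : θ = 0 := by
  have h0 : θ 1 - θ 0 + θ 0 ^ 3 = 0 := (xi_zero θ).symm.trans (congrFun h 0)
  have h1 : -θ 0 - θ 1 + θ 1 ^ 3 = 0 := (xi_one θ).symm.trans (congrFun h 1)
  have key : θ 0 ^ 4 + θ 1 ^ 4 + θ 0 * θ 1 * (θ 0 ^ 2 - θ 1 ^ 2) = 0 := by
    linear_combination (θ 0 + θ 1) * h0 + (θ 1 - θ 0) * h1
  have h2 : θ 0 ^ 4 + θ 1 ^ 4 ≤ 0 := by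
    nlinarith [sq_nonneg (θ 0 ^ 2 - θ 1 ^ 2), sq_nonneg (θ 0 * θ 1),
      sq_nonneg (θ 0 ^ 2 - θ 1 ^ 2 + 2 * (θ 0 * θ 1))]
  have p0 : θ 0 ^ 4 = 0 := by
    have := Even.pow_nonneg (by decide : Even 4) (θ 0)
    have := Even.pow_nonneg (by decide : Even 4) (θ 1)
    linarith
  have p1 : θ 1 ^ 4 = 0 := by
    have := Even.pow_nonneg (by decide : Even 4) (θ 0)
    have := Even.pow_nonneg (by decide : Even 4) (θ 1)
    linarith
  ext k
  fin_cases k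
  · exact pow_eq_zero_iff (by norm_num) |>.1 p0
  · exact pow_eq_zero_iff (by norm_num) |>.1 p1

theorem isCritical_zero : gameN.IsCritical 0 := by
  ext k
  fin_cases k
  · simp [xi_zero]
  · simp [xi_one]

theorem isStrictMax_zero : gameN.IsStrictMax 0 := by
  refine ⟨isCritical_zero, fun u hu => ?_⟩
  have h : u ⬝ᵥ (gameN.hess 0 *ᵥ u) = -(u 0 ^ 2 + u 1 ^ 2) := by
    simp [hess_eq, dotProduct, mulVec, Fin.sum_univ_two]
    ring
  rw [h, neg_lt_zero]
  by_contra hn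
  apply hu
  ext k
  fin_cases k
  · simp only [Fin.zero_eta, Pi.zero_apply]
    nlinarith [sq_nonneg (u 0), sq_nonneg (u 1)]
  · simp only [Fin.mk_one, Pi.zero_apply]
    nlinarith [sq_nonneg (u 0), sq_nonneg (u 1)]

/-! ### Structural properties of the game -/

theorem zeroSum : gameN.ZeroSum := fun θ => by
  rw [loss_zero, loss_one]
  ring

theorem nondegenerate : gameN.Nondegenerate := fun θ h => by
  rw [eq_zero_of_isCritical h, Matrix.isUnit_iff_isUnit_det, hess_eq, det_fin_two_of]
  norm_num

theorem analytic : gameN.Analytic := by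
  have h (i : Fin 2) : AnalyticOnNhd ℝ (fun η : Fin 2 → ℝ => η i) Set.univ :=
    (ContinuousLinearMap.proj i : (Fin 2 → ℝ) →L[ℝ] ℝ).analyticOnNhd _
  have h0 := h 0
  have h1 := h 1
  have hl : AnalyticOnNhd ℝ (gameN.loss 0) Set.univ := by
    simp only [loss_zero, div_eq_mul_inv]
    have hc (c : ℝ) : AnalyticOnNhd ℝ (fun _ : Fin 2 → ℝ => c) Set.univ := analyticOnNhd_const
    exact ((((h0.mul h1).sub ((h0.pow 2).mul (hc _))).add ((h1.pow 2).mul (hc _))).add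
      ((h0.pow 4).mul (hc _))).sub ((h1.pow 4).mul (hc _))
  intro i
  fin_cases i
  · exact hl
  · exact hl.neg

/-- On a set where one coordinate is constant, escape to infinity happens in the other one. -/
theorem tendsto_abs_coord (i j : Fin 2) (hij : ∀ k, k = i ∨ k = j) (c : ℝ) :
    Tendsto (fun η : Fin 2 → ℝ => |η i|) (cocompact (Fin 2 → ℝ) ⊓ 𝓟 {η | η j = c}) atTop := by
  rw [tendsto_atTop]
  intro b
  have h : ∀ᶠ η in cocompact (Fin 2 → ℝ), max b |c| < ‖η‖ :=
    tendsto_norm_cocompact_atTop.eventually_gt_atTop _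
  filter_upwards [h.filter_mono inf_le_left, mem_inf_of_right (mem_principal_self _)] with η h1 h2
  by_contra hb
  refine absurd h1 (not_lt.2 ((pi_norm_le_iff_of_nonneg
    ((abs_nonneg c).trans (le_max_right _ _))).2 fun k => ?_))
  rcases hij k with rfl | rfl
  · exact (not_le.1 hb).le.trans (le_max_left _ _)
  · rw [Real.norm_eq_abs, show η k = c from h2]
    exact le_max_right _ _

theorem weaklyCoercive : gameN.WeaklyCoercive := by
  -- Each loss has this form in its player's coordinate `t`: `c` is the other coordinate up to sign,
  -- and `-d` collects the terms without `t`.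
  have quartic (c d t : ℝ) : |t| - (c ^ 2 + 4 + d) ≤ t ^ 4 / 4 + c * t - t ^ 2 / 2 - d := by
    nlinarith [sq_nonneg (t ^ 2 - 4), sq_nonneg (c + t), sq_nonneg (|t| - 1), sq_abs t]
  intro i θ
  fin_cases i
  · have hs : {η : Fin 2 → ℝ | ∀ k, gameN.owner k ≠ 0 → η k = θ k} = {η | η 1 = θ 1} := by
      ext η
      simp [Fin.forall_fin_two]
    have ht := tendsto_atTop_add_const_right _ (-((θ 1) ^ 2 + 4 + ((θ 1) ^ 4 / 4 - (θ 1) ^ 2 / 2)))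
      (tendsto_abs_coord 0 1 (by decide) (θ 1))
    simp only [Fin.zero_eta, hs]
    refine tendsto_atTop_mono' _ ?_ ht
    filter_upwards [mem_inf_of_right (mem_principal_self _)] with η hη
    have hη : η 1 = θ 1 := hη
    rw [loss_zero]
    have := quartic (θ 1) ((θ 1) ^ 4 / 4 - (θ 1) ^ 2 / 2) (η 0)
    simp only [hη]
    linarith
  · have hs : {η : Fin 2 → ℝ | ∀ k, gameN.owner k ≠ 1 → η k = θ k} = {η | η 0 = θ 0} := by
      ext η
      simp [Fin.forall_fin_two]
    have ht := tendsto_atTop_add_const_right _ (-((-θ 0) ^ 2 + 4 + ((θ 0) ^ 4 / 4 - (θ 0) ^ 2 / 2)))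
      (tendsto_abs_coord 1 0 (by decide) (θ 0))
    simp only [Fin.mk_one, hs]
    refine tendsto_atTop_mono' _ ?_ ht
    filter_upwards [mem_inf_of_right (mem_principal_self _)] with η hη
    have hη : η 0 = θ 0 := hη
    rw [loss_one]
    have := quartic (-θ 0) ((θ 0) ^ 4 / 4 - (θ 0) ^ 2 / 2) (η 1)
    simp only [hη]
    linarith

end gameN

/-! ### Dynamics of small steps in the plane -/

namespace gameN

/-- One step `θ' = θ - α (ξ + λ Jᵀ ξ + e)` in coordinates: `(x, y)` is the current point, `(u, v)`
the next one, and the error `(e, f)` is small relative to `ξ`. -/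
structure PlaneStep (α l x y u v : ℝ) : Prop where
  abs_le : |l| ≤ 1
  nonpos : x ^ 2 + y ^ 2 ≤ 1 / 3 → l ≤ 0
  step : ∃ e f : ℝ,
    64 * (e ^ 2 + f ^ 2) ≤ (y - x + x ^ 3) ^ 2 + (-x - y + y ^ 3) ^ 2 ∧
    u = x - α * ((y - x + x ^ 3) - l * (-x - y + y ^ 3) + e) ∧
    v = y - α * ((-x - y + y ^ 3) + l * (y - x + x ^ 3) + f)

/-- The linear part of `ξ` contributes exactly `2r`, the cubic part at most `r³`, and their cross
term is nonpositive. -/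
theorem sq_xi_le (x y : ℝ) : (y - x + x ^ 3) ^ 2 + (-x - y + y ^ 3) ^ 2 ≤
    2 * (x ^ 2 + y ^ 2) + (x ^ 2 + y ^ 2) ^ 3 := by
  have h1 : 0 ≤ x ^ 4 + y ^ 4 - x * y * (x ^ 2 - y ^ 2) := by
    nlinarith [sq_nonneg (x ^ 2 - y ^ 2), sq_nonneg (x * y),
      sq_nonneg (x ^ 2 - y ^ 2 - 2 * (x * y))]
  have h2 : 0 ≤ x ^ 2 * y ^ 2 * (x ^ 2 + y ^ 2) := by positivity
  nlinarith

/-- In polar coordinates the quartic is `r² sin(4φ) / 4`, where `r = x² + y²`. -/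
theorem abs_quartic_le (x y : ℝ) : |x * y * (x ^ 2 - y ^ 2)| ≤ (x ^ 2 + y ^ 2) ^ 2 / 4 := by
  rw [abs_le]
  constructor
  · nlinarith [sq_nonneg (x ^ 2 - y ^ 2 + 2 * (x * y))]
  · nlinarith [sq_nonneg (x ^ 2 - y ^ 2 - 2 * (x * y))]

/-- The size of the direction of a step is controlled by the size of the point. -/
theorem sq_direction_le {l x y e f : ℝ} (hl : |l| ≤ 1)
    (he : 64 * (e ^ 2 + f ^ 2) ≤ (y - x + x ^ 3) ^ 2 + (-x - y + y ^ 3) ^ 2) :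
    ((y - x + x ^ 3) - l * (-x - y + y ^ 3) + e) ^ 2 +
      ((-x - y + y ^ 3) + l * (y - x + x ^ 3) + f) ^ 2 ≤
      5 * (2 * (x ^ 2 + y ^ 2) + (x ^ 2 + y ^ 2) ^ 3) := by
  have h := sq_xi_le x y
  set a := y - x + x ^ 3
  set b := -x - y + y ^ 3
  have hl2 : l ^ 2 ≤ 1 := (sq_le_one_iff_abs_le_one l).2 hl
  have h3 : l ^ 2 * (a ^ 2 + b ^ 2) ≤ 1 * (a ^ 2 + b ^ 2) := by gcongr
  -- The constant: `2 (1 + l²) + 2 / 64 ≤ 5`.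
  nlinarith [sq_nonneg (a - l * b - e), sq_nonneg (b + l * a - f)]

theorem inner_direction {x y : ℝ} (l e f : ℝ) :
    x * ((y - x + x ^ 3) - l * (-x - y + y ^ 3) + e) +
      y * ((-x - y + y ^ 3) + l * (y - x + x ^ 3) + f) =
    x ^ 4 + y ^ 4 - (x ^ 2 + y ^ 2) + l * (x ^ 2 + y ^ 2 + x * y * (x ^ 2 - y ^ 2)) +
      (x * e + y * f) := by
  ring

/-- Near the origin the steps point outwards. -/
theorem inner_direction_nonpos {l x y e f : ℝ}
    (hr : x ^ 2 + y ^ 2 ≤ 1 / 3) (hl0 : l ≤ 0)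
    (he : 64 * (e ^ 2 + f ^ 2) ≤ (y - x + x ^ 3) ^ 2 + (-x - y + y ^ 3) ^ 2) :
    x * ((y - x + x ^ 3) - l * (-x - y + y ^ 3) + e) +
      y * ((-x - y + y ^ 3) + l * (y - x + x ^ 3) + f) ≤ 0 := by
  rw [inner_direction]
  have h := sq_xi_le x y
  have hq := abs_le.1 (abs_quartic_le x y)
  have hr0 : 0 ≤ x ^ 2 + y ^ 2 := by positivity
  have hrr : (x ^ 2 + y ^ 2) ^ 2 ≤ (x ^ 2 + y ^ 2) / 3 := by nlinarith
  have hr3 : (x ^ 2 + y ^ 2) ^ 3 ≤ (x ^ 2 + y ^ 2) := by nlinarith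
  have h1 : x ^ 4 + y ^ 4 ≤ (x ^ 2 + y ^ 2) ^ 2 := by
    nlinarith [mul_nonneg (sq_nonneg x) (sq_nonneg y)]
  have h2 : l * (x ^ 2 + y ^ 2 + x * y * (x ^ 2 - y ^ 2)) ≤ 0 :=
    mul_nonpos_of_nonpos_of_nonneg hl0 (by linarith)
  have h3 : x * e + y * f ≤ (x ^ 2 + y ^ 2) / 8 + 2 * (e ^ 2 + f ^ 2) := by
    nlinarith [sq_nonneg (x - 4 * e), sq_nonneg (y - 4 * f)]
  -- With `r = x² + y²`, the terms add up to at most `r/3 - r + r/8 + 3r/32 ≤ 0`.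
  linarith

/-- Far from the origin the steps point inwards. -/
theorem le_inner_direction {l x y e f : ℝ} (hl : |l| ≤ 1) (hr : 32 ≤ x ^ 2 + y ^ 2)
    (he : 64 * (e ^ 2 + f ^ 2) ≤ (y - x + x ^ 3) ^ 2 + (-x - y + y ^ 3) ^ 2) :
    50 ≤ x * ((y - x + x ^ 3) - l * (-x - y + y ^ 3) + e) +
      y * ((-x - y + y ^ 3) + l * (y - x + x ^ 3) + f) := by
  rw [inner_direction]
  have h := sq_xi_le x y
  have hq := abs_quartic_le x y
  have h1 : (x ^ 2 + y ^ 2) ^ 2 / 2 ≤ x ^ 4 + y ^ 4 := by nlinarith [sq_nonneg (x ^ 2 - y ^ 2)]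
  set r := x ^ 2 + y ^ 2
  have h2 : |l * (r + x * y * (x ^ 2 - y ^ 2))| ≤ r + r ^ 2 / 4 := by
    rw [abs_mul]
    have := abs_add_le r (x * y * (x ^ 2 - y ^ 2))
    rw [abs_of_nonneg (by linarith : 0 ≤ r)] at this
    calc _ ≤ 1 * |r + x * y * (x ^ 2 - y ^ 2)| := by gcongr
      _ ≤ _ := by linarith
  have h3 : |x * e + y * f| ≤ r ^ 2 / 8 + r / 4 := by
    apply abs_le_of_sq_le_sq _ (by positivity)
    have h4 : (x * e + y * f) ^ 2 ≤ r * (e ^ 2 + f ^ 2) := by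
      simp only [r]
      nlinarith [sq_nonneg (x * f - y * e)]
    have h5 : r * (64 * (e ^ 2 + f ^ 2)) ≤ r * (2 * r + r ^ 3) := by
      gcongr
      exact he.trans h
    nlinarith [pow_nonneg (by linarith : 0 ≤ r) 3, sq_nonneg r]
  have h2 := (abs_le.1 h2).1
  have h3 := (abs_le.1 h3).1
  -- What remains is at least `r²/8 - 9r/4`, which increases for `r ≥ 32` and equals `56` at `r =
  -- 32`.
  nlinarith

namespace PlaneStep

variable {α l x y u v : ℝ}

/-- For `r ≥ 32` the inward drift, of order `α`, beats the second-order term; for `r ≤ 32` one step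
is too short to leave the disc. In `hαB`, `5 * (2 * B + B ^ 3)` bounds the squared direction, and
the extra `B` serves for `2 |⟨θ, d⟩| ≤ |θ|² + |d|²`. -/
theorem sq_le (h : PlaneStep α l x y u v) {B : ℝ} (hB : 64 ≤ B) (hα : 0 < α) (hα1 : α ≤ 1)
    (hαB : α * (5 * (2 * B + B ^ 3) + B) ≤ 1 / 10) (hr : x ^ 2 + y ^ 2 ≤ B) :
    u ^ 2 + v ^ 2 ≤ B := by
  obtain ⟨e, f, he, rfl, rfl⟩ := h.step
  have hs := sq_direction_le h.abs_le he
  have hin := le_inner_direction h.abs_le (x := x) (y := y) (e := e) (f := f)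
  set g := (y - x + x ^ 3) - l * (-x - y + y ^ 3) + e
  set k := (-x - y + y ^ 3) + l * (y - x + x ^ 3) + f
  have hr0 : 0 ≤ x ^ 2 + y ^ 2 := by positivity
  have hM : g ^ 2 + k ^ 2 ≤ 5 * (2 * B + B ^ 3) := hs.trans (by gcongr)
  have h1 : α * (g ^ 2 + k ^ 2) ≤ 1 / 10 := by
    refine le_trans (mul_le_mul_of_nonneg_left ?_ hα.le) hαB
    linarith
  have h2 : α * (α * (g ^ 2 + k ^ 2)) ≤ α * (1 / 10) := by gcongr
  clear_value g k
  have hexp : (x - α * g) ^ 2 + (y - α * k) ^ 2 =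
      x ^ 2 + y ^ 2 - 2 * (α * (x * g + y * k)) + α * (α * (g ^ 2 + k ^ 2)) := by ring
  rw [hexp]
  rcases le_total 32 (x ^ 2 + y ^ 2) with h32 | h32
  · have h3 : α * 50 ≤ α * (x * g + y * k) := by
      gcongr
      exact hin h32 he
    linarith
  · have h3 : -(2 * (x * g + y * k)) ≤ 5 * (2 * B + B ^ 3) + B := by
      linarith [sq_nonneg (x + g), sq_nonneg (y + k)]
    have h4 : α * (-(2 * (x * g + y * k))) ≤ 1 / 10 :=
      (mul_le_mul_of_nonneg_left h3 hα.le).trans hαB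
    linarith

theorem sq_le_sq_of_le (h : PlaneStep α l x y u v) (hα : 0 < α) (hr : x ^ 2 + y ^ 2 ≤ 1 / 3) :
    x ^ 2 + y ^ 2 ≤ u ^ 2 + v ^ 2 := by
  have hl := h.nonpos hr
  obtain ⟨e, f, he, rfl, rfl⟩ := h.step
  have hin := inner_direction_nonpos hr hl he
  nlinarith [mul_nonneg hα.le (neg_nonneg.2 hin),
    sq_nonneg (α * ((y - x + x ^ 3) - l * (-x - y + y ^ 3) + e)),
    sq_nonneg (α * ((-x - y + y ^ 3) + l * (y - x + x ^ 3) + f))]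

/-- Within `r ≤ 1/3` the steps do not approach the origin; from outside, one step lowers `r` by at
most `1/10`. -/
theorem sq_pos (h : PlaneStep α l x y u v) {B : ℝ} (hα : 0 < α)
    (hαB : α * (5 * (2 * B + B ^ 3) + B) ≤ 1 / 10) (hr : x ^ 2 + y ^ 2 ≤ B)
    (h0 : 0 < x ^ 2 + y ^ 2) : 0 < u ^ 2 + v ^ 2 := by
  rcases le_total (x ^ 2 + y ^ 2) (1 / 3) with h3 | h3
  · exact h0.trans_le (h.sq_le_sq_of_le hα h3)
  obtain ⟨e, f, he, rfl, rfl⟩ := h.step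
  have hs := sq_direction_le h.abs_le he
  set g := (y - x + x ^ 3) - l * (-x - y + y ^ 3) + e
  set k := (-x - y + y ^ 3) + l * (y - x + x ^ 3) + f
  have hM : g ^ 2 + k ^ 2 ≤ 5 * (2 * B + B ^ 3) := hs.trans (by gcongr)
  clear_value g k
  have h4 : 2 * (x * g + y * k) ≤ 5 * (2 * B + B ^ 3) + B := by
    linarith [sq_nonneg (x - g), sq_nonneg (y - k)]
  have h5 : α * (2 * (x * g + y * k)) ≤ 1 / 10 :=
    (mul_le_mul_of_nonneg_left h4 hα.le).trans hαB
  linarith [sq_nonneg (α * g), sq_nonneg (α * k)]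

/-- The displacement of a step controls `ξ`. -/
theorem sq_xi_le_sq_sub (h : PlaneStep α l x y u v) :
    α ^ 2 * ((y - x + x ^ 3) ^ 2 + (-x - y + y ^ 3) ^ 2) ≤ 4 * ((u - x) ^ 2 + (v - y) ^ 2) := by
  obtain ⟨e, f, he, rfl, rfl⟩ := h.step
  set a := y - x + x ^ 3
  set b := -x - y + y ^ 3
  have h1 : a ^ 2 + b ^ 2 ≤ 4 * ((a - l * b + e) ^ 2 + (b + l * a + f) ^ 2) := by
    nlinarith [sq_nonneg (a - l * b + 2 * e), sq_nonneg (b + l * a + 2 * f),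
      mul_nonneg (sq_nonneg l) (sq_nonneg a), mul_nonneg (sq_nonneg l) (sq_nonneg b)]
  nlinarith [mul_le_mul_of_nonneg_left h1 (sq_nonneg α)]

end PlaneStep

/-- Sequences of small steps from a point other than the origin stay bounded. -/
theorem sq_le_and_sq_pos_of_planeStep {α B : ℝ} (hB : 64 ≤ B) (hα : 0 < α) (hα1 : α ≤ 1)
    (hαB : α * (5 * (2 * B + B ^ 3) + B) ≤ 1 / 10) {z : ℕ → Fin 2 → ℝ}
    (h0 : z 0 ≠ 0) (h0B : z 0 0 ^ 2 + z 0 1 ^ 2 ≤ B)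
    (hz : ∀ k, (∀ j ≤ k, z j 0 ^ 2 + z j 1 ^ 2 ≤ B) →
      ∃ l, PlaneStep α l (z k 0) (z k 1) (z (k + 1) 0) (z (k + 1) 1)) (k : ℕ) :
    z k 0 ^ 2 + z k 1 ^ 2 ≤ B ∧ 0 < z k 0 ^ 2 + z k 1 ^ 2 := by
  -- Strong induction, because with memory the step at `k` is known to be small only once all
  -- earlier points lie in the disc.
  induction k using Nat.strong_induction_on with
  | _ k ih =>
    cases k with
    | zero =>
      refine ⟨h0B, ?_⟩
      by_contra hn
      apply h0
      ext i
      fin_cases i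
      · simp only [Fin.zero_eta, Pi.zero_apply]
        nlinarith [sq_nonneg (z 0 0), sq_nonneg (z 0 1)]
      · simp only [Fin.mk_one, Pi.zero_apply]
        nlinarith [sq_nonneg (z 0 0), sq_nonneg (z 0 1)]
    | succ k =>
      obtain ⟨l, hl⟩ := hz k fun j hj => (ih j (by omega)).1
      obtain ⟨hk, hk0⟩ := ih k (by omega)
      exact ⟨hl.sq_le hB hα hα1 hαB hk, hl.sq_pos hα hαB hk hk0⟩

/-- Sequences of small steps from a point other than the origin do not converge. -/
theorem not_tendsto_of_planeStep {α : ℝ} (hα : 0 < α) {z : ℕ → Fin 2 → ℝ}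
    (hpos : ∀ k, 0 < z k 0 ^ 2 + z k 1 ^ 2)
    (hz : ∀ k, ∃ l, PlaneStep α l (z k 0) (z k 1) (z (k + 1) 0) (z (k + 1) 1)) :
    ¬ ∃ c, Tendsto z atTop (𝓝 c) := by
  rintro ⟨c, hc⟩
  have hc' := hc.comp (tendsto_add_atTop_nat 1)
  have lim (i : Fin 2) : Tendsto (fun k => z k i) atTop (𝓝 (c i)) := tendsto_pi_nhds.1 hc i
  have lim' (i : Fin 2) : Tendsto (fun k => z (k + 1) i) atTop (𝓝 (c i)) :=
    tendsto_pi_nhds.1 hc' i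
  have hsub := ((((lim' 0).sub (lim 0)).pow 2).add (((lim' 1).sub (lim 1)).pow 2)).const_mul 4
  have hxi := (((((lim 1).sub (lim 0)).add ((lim 0).pow 3)).pow 2).add
    (((((lim 0).neg).sub (lim 1)).add ((lim 1).pow 3)).pow 2)).const_mul (α ^ 2)
  -- Displacements of a convergent sequence vanish, which forces `ξ(c) = 0`.
  have hle := le_of_tendsto_of_tendsto' hxi hsub fun k => (hz k).choose_spec.sq_xi_le_sq_sub
  simp only [sub_self] at hle
  have hle' : (c 1 - c 0 + c 0 ^ 3) ^ 2 + (-c 0 - c 1 + c 1 ^ 3) ^ 2 ≤ 0 := by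
    have : 0 < α ^ 2 := by positivity
    nlinarith
  have hcrit : gameN.IsCritical c := by
    ext i
    fin_cases i
    · refine (xi_zero c).trans (pow_eq_zero_iff two_ne_zero |>.1 ?_)
      nlinarith [sq_nonneg (c 1 - c 0 + c 0 ^ 3), sq_nonneg (-c 0 - c 1 + c 1 ^ 3)]
    · refine (xi_one c).trans (pow_eq_zero_iff two_ne_zero |>.1 ?_)
      nlinarith [sq_nonneg (c 1 - c 0 + c 0 ^ 3), sq_nonneg (-c 0 - c 1 + c 1 ^ 3)]
  have hc0 := eq_zero_of_isCritical hcrit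
  have hsq : Tendsto (fun k => z k 0 ^ 2 + z k 1 ^ 2) atTop (𝓝 0) := by
    simpa [hc0] using ((lim 0).pow 2).add ((lim 1).pow 2)
  obtain ⟨K, hK⟩ := eventually_atTop.1 (hsq.eventually_le_const (by norm_num : (0 : ℝ) < 1 / 3))
  -- The tail stays in the repelling disc, so its squared radius never drops below the positive
  -- value at `K`.
  have hmono (m : ℕ) : z K 0 ^ 2 + z K 1 ^ 2 ≤ z (K + m) 0 ^ 2 + z (K + m) 1 ^ 2 := by
    induction m with
    | zero => exact le_rfl
    | succ m ih =>
      exact ih.trans ((hz (K + m)).choose_spec.sq_le_sq_of_le hα (hK _ (by omega)))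
  obtain ⟨N, hN⟩ := eventually_atTop.1 (hsq.eventually_lt_const (hpos K))
  exact absurd (hN (K + N) (by omega)) (not_lt.2 (hmono N))

end gameN

/-! ### From update directions to plane steps -/

namespace gameN

open TwoPlayerGame

/-- The matrix `H_o = A` of the game, as a map. -/
def rot (v : Fin 2 → ℝ) : Fin 2 → ℝ := ![v 1, -v 0]

theorem norm_le_of_coord {v : Fin 2 → ℝ} {c : ℝ} (h0 : |v 0| ≤ c) (h1 : |v 1| ≤ c) : ‖v‖ ≤ c := by
  refine (pi_norm_le_iff_of_nonneg ((abs_nonneg _).trans h0)).2 fun i => ?_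
  fin_cases i
  · exact h0
  · exact h1

theorem abs_coord_le (v : Fin 2 → ℝ) (i : Fin 2) : |v i| ≤ ‖v‖ := norm_le_pi_norm v i

theorem norm_rot_le (v : Fin 2 → ℝ) : ‖rot v‖ ≤ ‖v‖ :=
  norm_le_of_coord (abs_coord_le v 1) ((abs_neg _).trans_le (abs_coord_le v 0))

theorem sq_norm_le (v : Fin 2 → ℝ) : ‖v‖ ^ 2 ≤ v 0 ^ 2 + v 1 ^ 2 := by
  refine (Real.le_sqrt (norm_nonneg _) (by positivity)).1 (norm_le_of_coord ?_ ?_)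
  · exact Real.abs_le_sqrt (by linarith [sq_nonneg (v 1)])
  · exact Real.abs_le_sqrt (by linarith [sq_nonneg (v 0)])

/-- `d` is, up to a small relative error, an admissible update direction at `θ`. -/
def NearXi (θ d : Fin 2 → ℝ) : Prop :=
  ∃ l : ℝ, |l| ≤ 1 ∧ (θ 0 ^ 2 + θ 1 ^ 2 ≤ 1 / 3 → l ≤ 0) ∧
    ‖d - (gameN.xi θ - l • rot (gameN.xi θ))‖ ≤ ‖gameN.xi θ‖ / 12

theorem NearXi.of_norm_sub_le {θ d : Fin 2 → ℝ} (h : ‖d - gameN.xi θ‖ ≤ ‖gameN.xi θ‖ / 12) :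
    NearXi θ d :=
  ⟨0, by simp, fun _ => le_rfl, by simpa using h⟩

theorem NearXi.planeStep {θ d : Fin 2 → ℝ} (h : NearXi θ d) (α : ℝ) :
    ∃ l, PlaneStep α l (θ 0) (θ 1) ((θ - α • d) 0) ((θ - α • d) 1) := by
  obtain ⟨l, hl, hl0, hd⟩ := h
  set w := d - (gameN.xi θ - l • rot (gameN.xi θ))
  refine ⟨l, hl, hl0, w 0, w 1, ?_, ?_, ?_⟩
  · have h0 : |w 0| ≤ |‖gameN.xi θ‖ / 12| :=
      ((abs_coord_le w 0).trans hd).trans (le_abs_self _)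
    have h1 : |w 1| ≤ |‖gameN.xi θ‖ / 12| :=
      ((abs_coord_le w 1).trans hd).trans (le_abs_self _)
    have h0 := sq_le_sq.2 h0
    have h1 := sq_le_sq.2 h1
    have h2 := sq_norm_le (gameN.xi θ)
    rw [← xi_zero, ← xi_one]
    -- Passing from the sup norm to squares: `64 * 2 / 12² ≤ 1`.
    linarith [sq_nonneg ‖gameN.xi θ‖]
  · have h0 : w 0 = d 0 - (gameN.xi θ 0 - l * gameN.xi θ 1) := rfl
    rw [← xi_zero, ← xi_one, h0, Pi.sub_apply, Pi.smul_apply, smul_eq_mul]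
    ring
  · have h1 : w 1 = d 1 - (gameN.xi θ 1 - l * -gameN.xi θ 0) := rfl
    rw [← xi_zero, ← xi_one, h1, Pi.sub_apply, Pi.smul_apply, smul_eq_mul]
    ring

theorem norm_xi_sub_le {a b : Fin 2 → ℝ} {s : ℝ} (ha : ‖a‖ ≤ s) (hb : ‖b‖ ≤ s) :
    ‖gameN.xi a - gameN.xi b‖ ≤ (2 + 3 * s ^ 2) * ‖a - b‖ := by
  have cube (i : Fin 2) : |a i ^ 3 - b i ^ 3| ≤ 3 * s ^ 2 * ‖a - b‖ := by
    have hai := (abs_coord_le a i).trans ha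
    have hbi := (abs_coord_le b i).trans hb
    have hs : 0 ≤ s := (abs_nonneg _).trans hai
    have h1 : |a i ^ 2 + a i * b i + b i ^ 2| ≤ 3 * s ^ 2 := by
      have h2 := abs_add_three (a i ^ 2) (a i * b i) (b i ^ 2)
      rw [abs_pow, abs_pow, abs_mul] at h2
      have h3 : |a i| ^ 2 ≤ s ^ 2 := by gcongr
      have h4 : |b i| ^ 2 ≤ s ^ 2 := by gcongr
      have h5 : |a i| * |b i| ≤ s * s := by gcongr
      linarith
    rw [show a i ^ 3 - b i ^ 3 = (a i ^ 2 + a i * b i + b i ^ 2) * (a i - b i) by ring, abs_mul]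
    exact mul_le_mul h1 (abs_coord_le (a - b) i) (abs_nonneg _) (by positivity)
  have h0 := abs_coord_le (a - b) 0
  have h1 := abs_coord_le (a - b) 1
  simp only [Pi.sub_apply] at h0 h1
  apply norm_le_of_coord
  · rw [Pi.sub_apply, xi_zero, xi_zero]
    have := abs_add_three (a 1 - b 1) (-(a 0 - b 0)) (a 0 ^ 3 - b 0 ^ 3)
    rw [abs_neg] at this
    have hc := cube 0
    rw [show a 1 - a 0 + a 0 ^ 3 - (b 1 - b 0 + b 0 ^ 3) =
      (a 1 - b 1) + -(a 0 - b 0) + (a 0 ^ 3 - b 0 ^ 3) by ring]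
    linarith
  · rw [Pi.sub_apply, xi_one, xi_one]
    have := abs_add_three (-(a 0 - b 0)) (-(a 1 - b 1)) (a 1 ^ 3 - b 1 ^ 3)
    rw [abs_neg, abs_neg] at this
    have hc := cube 1
    rw [show -a 0 - a 1 + a 1 ^ 3 - (-b 0 - b 1 + b 1 ^ 3) =
      -(a 0 - b 0) + -(a 1 - b 1) + (a 1 ^ 3 - b 1 ^ 3) by ring]
    linarith

theorem norm_xi_le {a : Fin 2 → ℝ} {s : ℝ} (ha : ‖a‖ ≤ s) :
    ‖gameN.xi a‖ ≤ (2 + 3 * s ^ 2) * ‖a‖ := by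
  have h := norm_xi_sub_le ha (b := 0) (by simpa using (norm_nonneg a).trans ha)
  rwa [show gameN.xi 0 = 0 from isCritical_zero, sub_zero, sub_zero] at h

theorem continuous_xi : Continuous gameN.xi := by
  refine continuous_pi fun i => ?_
  fin_cases i
  · simp only [Fin.zero_eta, xi_zero]
    fun_prop
  · simp only [Fin.mk_one, xi_one]
    fun_prop

/-- The learning rate and the hyperparameter are small in comparison with the radius `ρ`. -/
structure SmallRates (ρ α γ : ℝ) : Prop where
  radius : 8 ≤ ρ
  pos : 0 < α
  pos' : 0 < γ
  -- `2 + 3 (ρ + 1)²` is a Lipschitz constant of `ξ` on the ball of radius `ρ + 1`, and the last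
  -- factor turns it into a bound for `ξ` itself. The extra `1` leaves room for extrapolated and
  -- proximal points.
  rate : α * ((2 + 3 * (ρ + 1) ^ 2) * (ρ + 1)) ≤ 1 / 64
  rate' : γ * ((2 + 3 * (ρ + 1) ^ 2) * (ρ + 1)) ≤ 1 / 64

namespace SmallRates

variable {ρ α γ : ℝ}

theorem mul_lipschitz_le_aux (hρ : 8 ≤ ρ) {β : ℝ} (hβ : 0 < β)
    (h : β * ((2 + 3 * (ρ + 1) ^ 2) * (ρ + 1)) ≤ 1 / 64) :
    β * (2 + 3 * (ρ + 1) ^ 2) ≤ 1 / 64 := by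
  refine le_trans (mul_le_mul_of_nonneg_left ?_ hβ.le) h
  exact le_mul_of_one_le_right (by positivity) (by linarith)

theorem mul_lipschitz_le (h : SmallRates ρ α γ) : α * (2 + 3 * (ρ + 1) ^ 2) ≤ 1 / 64 :=
  mul_lipschitz_le_aux h.radius h.pos h.rate

theorem mul_lipschitz_le' (h : SmallRates ρ α γ) : γ * (2 + 3 * (ρ + 1) ^ 2) ≤ 1 / 64 :=
  mul_lipschitz_le_aux h.radius h.pos' h.rate'

theorem le (h : SmallRates ρ α γ) : α ≤ 1 / 128 := by
  have h1 := h.mul_lipschitz_le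
  have h2 : 0 ≤ α * (3 * (ρ + 1) ^ 2) := mul_nonneg h.pos.le (by positivity)
  linarith

theorem smul_xi_le (h : SmallRates ρ α γ) {θ : Fin 2 → ℝ} (hθ : ‖θ‖ ≤ ρ + 1) :
    ‖α • gameN.xi θ‖ ≤ 1 / 64 := by
  rw [norm_smul, Real.norm_of_nonneg h.pos.le]
  refine le_trans (mul_le_mul_of_nonneg_left ?_ h.pos.le) h.rate
  exact (norm_xi_le hθ).trans (by gcongr)

theorem smul_xi_sub_le (h : SmallRates ρ α γ) {a b : Fin 2 → ℝ} (ha : ‖a‖ ≤ ρ + 1)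
    (hb : ‖b‖ ≤ ρ + 1) : α * ‖gameN.xi a - gameN.xi b‖ ≤ ‖a - b‖ / 64 := by
  have h1 := mul_le_mul_of_nonneg_left (norm_xi_sub_le ha hb) h.pos.le
  have h2 := mul_le_mul_of_nonneg_right h.mul_lipschitz_le (norm_nonneg (a - b))
  linarith

/-- Differences of `ξ` at points whose distance is of the order `α ‖ξ‖`. -/
theorem xi_sub_le (h : SmallRates ρ α γ) {a b : Fin 2 → ℝ} (ha : ‖a‖ ≤ ρ + 1)
    (hb : ‖b‖ ≤ ρ + 1) {c t : ℝ} (hc : 0 ≤ c) (hab : ‖a - b‖ ≤ t * α * c) (ht : 0 ≤ t) :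
    ‖gameN.xi a - gameN.xi b‖ ≤ t * c / 64 := by
  have h1 := norm_xi_sub_le ha hb
  have h2 : (2 + 3 * (ρ + 1) ^ 2) * ‖a - b‖ ≤ (2 + 3 * (ρ + 1) ^ 2) * (t * α * c) := by gcongr
  have h3 := mul_le_mul_of_nonneg_right h.mul_lipschitz_le (mul_nonneg ht hc)
  linarith

/-- Picard iteration: on the ball of radius `ρ + 1` the map contracts by `1/64`, and the iterates
stay in that ball. -/
theorem exists_tendsto_prox (h : SmallRates ρ α γ) {θ : Fin 2 → ℝ} (hθ : ‖θ‖ ≤ ρ) :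
    ∃ η, Tendsto (gameN.prox α θ) atTop (𝓝 η) ∧ ‖η‖ ≤ ρ + 1 ∧ θ + α • gameN.xi η = η := by
  have hsucc (m : ℕ) : gameN.prox α θ (m + 1) = θ + α • gameN.xi (gameN.prox α θ m) :=
    Function.iterate_succ_apply' _ _ _
  have hball (m : ℕ) : ‖gameN.prox α θ m‖ ≤ ρ + 1 := by
    induction m with
    | zero => exact hθ.trans (by linarith)
    | succ m ih =>
      rw [hsucc]
      exact (norm_add_le _ _).trans (by linarith [h.smul_xi_le ih])
  have hdist (m : ℕ) : dist (gameN.prox α θ m) (gameN.prox α θ (m + 1)) ≤ 1 * (1 / 64) ^ m := by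
    induction m with
    | zero =>
      rw [hsucc, dist_eq_norm]
      have h1 := h.smul_xi_le (hball 0)
      rw [show gameN.prox α θ 0 = θ from rfl] at h1 ⊢
      rw [sub_add_cancel_left, norm_neg]
      linarith
    | succ m ih =>
      rw [dist_eq_norm] at ih ⊢
      rw [hsucc (m + 1)]
      nth_rewrite 1 [hsucc m]
      rw [add_sub_add_left_eq_sub, ← smul_sub, norm_smul, Real.norm_of_nonneg h.pos.le]
      have h1 := h.smul_xi_sub_le (hball m) (hball (m + 1))
      rw [pow_succ]
      linarith
  obtain ⟨η, hη⟩ := cauchySeq_tendsto_of_complete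
    (cauchySeq_of_le_geometric (1 / 64) 1 (by norm_num) hdist)
  refine ⟨η, hη, le_of_tendsto' hη.norm hball, ?_⟩
  have h1 := ((continuous_xi.tendsto η).comp hη).const_smul α |>.const_add θ
  have h2 := hη.comp (tendsto_add_atTop_nat 1)
  exact tendsto_nhds_unique h1 (h2.congr hsucc)

end SmallRates

/-! ### The individual algorithms -/

/-- Covers LA, LOLA and SOS, as `H_o ξ` and `χ` are both `rot ξ`. There `c > 0`, which is not
allowed as `l` near the origin, so the term is counted as error. -/
theorem nearXi_of_rot {θ d : Fin 2 → ℝ} {c : ℝ} (hc : |c| ≤ 1 / 12)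
    (hd : d = gameN.xi θ - c • rot (gameN.xi θ)) : NearXi θ d := by
  refine NearXi.of_norm_sub_le ?_
  rw [hd, sub_sub_cancel_left, norm_neg, norm_smul, Real.norm_eq_abs]
  have := mul_le_mul hc (norm_rot_le (gameN.xi θ)) (norm_nonneg _) (by norm_num)
  linarith

theorem hessOff_mulVec (θ v : Fin 2 → ℝ) : gameN.hessOff θ *ᵥ v = rot v := by
  ext i
  fin_cases i <;> simp [hessOff_eq, rot, mulVec, dotProduct]

theorem hessAnti_transpose_mulVec (θ v : Fin 2 → ℝ) : (gameN.hessAnti θ)ᵀ *ᵥ v = -rot v := by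
  ext i
  fin_cases i <;> simp [hessAnti_eq, rot, mulVec, dotProduct]

theorem hess_transpose_mulVec (θ v : Fin 2 → ℝ) :
    (gameN.hess θ)ᵀ *ᵥ v =
      ![(-1 + 3 * θ 0 ^ 2) * v 0 - v 1, v 0 + (-1 + 3 * θ 1 ^ 2) * v 1] := by
  ext i
  fin_cases i <;> simp [hess_eq, mulVec, dotProduct]
  ring

theorem chi_eq_rot (θ : Fin 2 → ℝ) : gameN.chi θ = rot (gameN.xi θ) := chi_eq θ

theorem isUnit_one_add_hessOff (α : ℝ) (θ : Fin 2 → ℝ) :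
    IsUnit (1 + α • gameN.hessOff θ) := by
  have h : (1 + α • gameN.hessOff θ).det = 1 + α * α := by
    rw [hessOff_eq, det_fin_two]
    simp
  rw [Matrix.isUnit_iff_isUnit_det, isUnit_iff_ne_zero, h]
  linarith [mul_self_nonneg α]

theorem norm_hess_transpose_mulVec_le {θ : Fin 2 → ℝ} {s : ℝ} (hθ : ‖θ‖ ≤ s) (v : Fin 2 → ℝ) :
    ‖(gameN.hess θ)ᵀ *ᵥ v‖ ≤ (2 + 3 * s ^ 2) * ‖v‖ := by
  have entry (i : Fin 2) : |-1 + 3 * θ i ^ 2| ≤ 1 + 3 * s ^ 2 := by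
    have h2 : |θ i| ^ 2 ≤ s ^ 2 := by
      gcongr
      exact (abs_coord_le θ i).trans hθ
    rw [sq_abs] at h2
    rw [abs_le]
    constructor <;> linarith [sq_nonneg (θ i)]
  have hmul (i : Fin 2) : |(-1 + 3 * θ i ^ 2) * v i| ≤ (1 + 3 * s ^ 2) * ‖v‖ := by
    rw [abs_mul]
    exact mul_le_mul (entry i) (abs_coord_le v i) (abs_nonneg _) (by positivity)
  rw [hess_transpose_mulVec]
  apply norm_le_of_coord
  · have := abs_sub ((-1 + 3 * θ 0 ^ 2) * v 0) (v 1)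
    simp only [cons_val_zero]
    linarith [hmul 0, abs_coord_le v 1]
  · have := abs_add_le (v 0) ((-1 + 3 * θ 1 ^ 2) * v 1)
    simp only [cons_val_one, cons_val_fin_one]
    linarith [hmul 1, abs_coord_le v 0]

/-- Near the origin the sign of `SGA` is not positive. -/
theorem sga_sign_nonpos {θ : Fin 2 → ℝ} (h : θ 0 ^ 2 + θ 1 ^ 2 ≤ 1 / 3) (v : Fin 2 → ℝ) :
    Real.sign ((v ⬝ᵥ ((gameN.hess θ)ᵀ *ᵥ v)) *
      (((gameN.hessAnti θ)ᵀ *ᵥ v) ⬝ᵥ ((gameN.hess θ)ᵀ *ᵥ v))) ≤ 0 := by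
  have h0 : v ⬝ᵥ ((gameN.hess θ)ᵀ *ᵥ v) ≤ 0 := by
    rw [hess_transpose_mulVec]
    simp only [dotProduct, Fin.sum_univ_two, cons_val_zero, cons_val_one, cons_val_fin_one]
    have e0 : (1 - 3 * θ 0 ^ 2) * v 0 ^ 2 ≥ 0 :=
      mul_nonneg (by linarith [sq_nonneg (θ 1)]) (sq_nonneg _)
    have e1 : (1 - 3 * θ 1 ^ 2) * v 1 ^ 2 ≥ 0 :=
      mul_nonneg (by linarith [sq_nonneg (θ 0)]) (sq_nonneg _)
    linarith
  have h1 : 0 ≤ ((gameN.hessAnti θ)ᵀ *ᵥ v) ⬝ᵥ ((gameN.hess θ)ᵀ *ᵥ v) := by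
    rw [hess_transpose_mulVec, hessAnti_transpose_mulVec]
    simp only [rot, dotProduct, Fin.sum_univ_two, cons_val_zero, cons_val_one, cons_val_fin_one,
      Pi.neg_apply]
    -- The form `v₀² + v₁² + 3 (y² - x²) v₀ v₁` is diagonal in `v₀ + v₁` and `v₀ - v₁`.
    have e0 : 0 ≤ (1 + 3 / 2 * (θ 1 ^ 2 - θ 0 ^ 2)) * (v 0 + v 1) ^ 2 :=
      mul_nonneg (by linarith [sq_nonneg (θ 1)]) (sq_nonneg _)
    have e1 : 0 ≤ (1 - 3 / 2 * (θ 1 ^ 2 - θ 0 ^ 2)) * (v 0 - v 1) ^ 2 :=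
      mul_nonneg (by linarith [sq_nonneg (θ 0)]) (sq_nonneg _)
    linarith
  rcases (mul_nonpos_of_nonpos_of_nonneg h0 h1).lt_or_eq with h2 | h2
  · rw [Real.sign_of_neg h2]
    norm_num
  · rw [h2, Real.sign_zero]

theorem abs_sign_le (r : ℝ) : |Real.sign r| ≤ 1 := by
  rcases Real.sign_apply_eq r with h | h | h <;> simp [h]

variable {ρ α γ : ℝ} {θ prev : Fin 2 → ℝ}

theorem nearXi_agd (h : SmallRates ρ α γ) :
    NearXi θ (Algorithm.agd.direction gameN α γ prev θ) := by
  refine NearXi.of_norm_sub_le (norm_le_of_coord ?_ ?_)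
  · simp only [Algorithm.direction, owner_eq, Pi.sub_apply, if_true, sub_self, abs_zero]
    positivity
  · simp only [Algorithm.direction, owner_eq, Pi.sub_apply, one_ne_zero, if_false]
    rw [xi_one, xi_one θ]
    simp only [if_true, one_ne_zero, if_false]
    rw [show -(θ 0 - α * gameN.xi θ 0) - θ 1 + θ 1 ^ 3 - (-θ 0 - θ 1 + θ 1 ^ 3) =
      α * gameN.xi θ 0 by ring, abs_mul, abs_of_pos h.pos]
    have := mul_le_mul h.le (abs_coord_le (gameN.xi θ) 0) (abs_nonneg _) (by norm_num)
    linarith [norm_nonneg (gameN.xi θ)]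

theorem nearXi_eg (h : SmallRates ρ α γ) (hθ : ‖θ‖ ≤ ρ) :
    NearXi θ (Algorithm.eg.direction gameN α γ prev θ) := by
  refine NearXi.of_norm_sub_le ?_
  have h1 := h.smul_xi_le (hθ.trans (by linarith))
  have h2 := h.xi_sub_le (a := θ - α • gameN.xi θ) (b := θ) (t := 1)
    ((norm_sub_le _ _).trans (by linarith)) (by linarith) (norm_nonneg (gameN.xi θ))
    (by rw [sub_sub_cancel_left, norm_neg, norm_smul, Real.norm_of_nonneg h.pos.le, one_mul])
    zero_le_one
  exact h2.trans (by linarith [norm_nonneg (gameN.xi θ)])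

theorem norm_omd_direction_sub_le (h : SmallRates ρ α γ) (hθ : ‖θ‖ ≤ ρ) (hprev : ‖prev‖ ≤ ρ)
    (hw : ‖θ - prev‖ ≤ 2 * α * ‖gameN.xi θ‖) :
    ‖Algorithm.omd.direction gameN α γ prev θ - gameN.xi θ‖ ≤ ‖gameN.xi θ‖ / 32 := by
  have h2 := h.xi_sub_le (a := θ) (b := prev) (t := 2) (by linarith) (by linarith)
    (norm_nonneg (gameN.xi θ)) hw zero_le_two
  have h3 : Algorithm.omd.direction gameN α γ prev θ - gameN.xi θ =
      gameN.xi θ - gameN.xi prev := by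
    simp only [Algorithm.direction, two_smul]
    abel
  rw [h3]
  linarith

/-- The displacement of optimistic mirror descent stays small in comparison with `ξ`. -/
theorem omd_displacement_le (h : SmallRates ρ α γ) (hθ : ‖θ‖ ≤ ρ) (hprev : ‖prev‖ ≤ ρ)
    (hw : ‖θ - prev‖ ≤ 2 * α * ‖gameN.xi θ‖) {next : Fin 2 → ℝ} (hnext : ‖next‖ ≤ ρ)
    (hstep : next = θ - α • Algorithm.omd.direction gameN α γ prev θ) :
    ‖next - θ‖ ≤ 2 * α * ‖gameN.xi next‖ := by
  have h1 := norm_omd_direction_sub_le h hθ hprev hw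
  set d := Algorithm.omd.direction gameN α γ prev θ
  have h2 : ‖next - θ‖ = α * ‖d‖ := by
    rw [hstep, sub_sub_cancel_left, norm_neg, norm_smul, Real.norm_of_nonneg h.pos.le]
  have h3 : ‖d‖ ≤ 33 / 32 * ‖gameN.xi θ‖ := by
    have := norm_le_norm_add_norm_sub' d (gameN.xi θ)
    linarith
  -- Replacing `ξ(θ)` by `ξ(next)` costs a small multiple of the displacement itself, which is
  -- absorbed on the left.
  have h4 := h.smul_xi_sub_le (a := next) (b := θ) (by linarith) (by linarith)
  have h5 : ‖gameN.xi θ‖ ≤ ‖gameN.xi next‖ + ‖gameN.xi next - gameN.xi θ‖ :=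
    norm_le_norm_add_norm_sub _ _
  have h6 := mul_le_mul_of_nonneg_left h3 h.pos.le
  have h7 := mul_le_mul_of_nonneg_left h5 h.pos.le
  have h8 := mul_nonneg h.pos.le (norm_nonneg (gameN.xi next))
  linarith

/-- The fixed-point equation gives `‖θ - η‖ = α ‖ξ(η)‖`; by the Lipschitz bound `ξ(η)` is comparable
to `ξ(θ)`. -/
theorem nearXi_omdProx (h : SmallRates ρ α γ) (hθ : ‖θ‖ ≤ ρ) :
    NearXi θ (Algorithm.omdProx.direction gameN α γ prev θ) := by
  obtain ⟨η, hη, hηρ, hfix⟩ := h.exists_tendsto_prox hθ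
  have hinv : gameN.proxInv α θ = η := hη.limUnder_eq
  refine NearXi.of_norm_sub_le ?_
  have h3 : Algorithm.omdProx.direction gameN α γ prev θ - gameN.xi θ =
      gameN.xi θ - gameN.xi η := by
    simp only [Algorithm.direction, two_smul, hinv]
    abel
  have h1 := h.xi_sub_le (a := θ) (b := η) (t := 1) (by linarith) hηρ
    (norm_nonneg (gameN.xi η)) (by
      rw [one_mul]
      nth_rewrite 1 [← hfix]
      rw [sub_add_cancel_left, norm_neg, norm_smul, Real.norm_of_nonneg h.pos.le]) zero_le_one
  have h2 : ‖gameN.xi η‖ ≤ ‖gameN.xi θ‖ + ‖gameN.xi θ - gameN.xi η‖ :=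
    norm_le_norm_add_norm_sub _ _
  rw [h3]
  linarith [norm_nonneg (gameN.xi θ)]

/-- The correction of SGA does not shrink with the rates; it is what `l` is for, and it leaves no
error. -/
theorem nearXi_sga : NearXi θ (Algorithm.sga.direction gameN α γ prev θ) := by
  refine ⟨_, abs_sign_le _, fun hr => sga_sign_nonpos hr (gameN.xi θ), ?_⟩
  simp only [Algorithm.direction]
  rw [add_mulVec, one_mulVec, smul_mulVec, hessAnti_transpose_mulVec, smul_neg, ← sub_eq_add_neg,
    sub_self, norm_zero]
  positivity

theorem nearXi_co (h : SmallRates ρ α γ) (hθ : ‖θ‖ ≤ ρ) :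
    NearXi θ (Algorithm.co.direction gameN α γ prev θ) := by
  refine NearXi.of_norm_sub_le ?_
  simp only [Algorithm.direction]
  rw [add_mulVec, one_mulVec, smul_mulVec, add_sub_cancel_left, norm_smul,
    Real.norm_of_nonneg h.pos'.le]
  have h1 := norm_hess_transpose_mulVec_le (hθ.trans (by linarith : ρ ≤ ρ + 1)) (gameN.xi θ)
  have h2 := mul_le_mul_of_nonneg_left h1 h.pos'.le
  have h3 := mul_le_mul_of_nonneg_right h.mul_lipschitz_le' (norm_nonneg (gameN.xi θ))
  linarith [norm_nonneg (gameN.xi θ)]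

theorem nearXi_cgd (h : SmallRates ρ α γ) :
    NearXi θ (Algorithm.cgd.direction gameN α γ prev θ) := by
  set d := Algorithm.cgd.direction gameN α γ prev θ with hd
  -- The implicit equation for `d` replaces any computation with the inverse.
  have h1 : d + α • rot d = gameN.xi θ := by
    have h2 : (1 + α • gameN.hessOff θ) *ᵥ d = gameN.xi θ := by
      simp only [hd, Algorithm.direction]
      rw [mulVec_mulVec, mul_nonsing_inv _
        ((Matrix.isUnit_iff_isUnit_det _).1 (isUnit_one_add_hessOff α θ)), one_mulVec]
    rwa [add_mulVec, one_mulVec, smul_mulVec, hessOff_mulVec] at h2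
  refine NearXi.of_norm_sub_le ?_
  have h2 : ‖d - gameN.xi θ‖ ≤ 1 / 128 * ‖d‖ := by
    rw [← h1, sub_add_cancel_left, norm_neg, norm_smul, Real.norm_of_nonneg h.pos.le]
    exact mul_le_mul h.le (norm_rot_le d) (norm_nonneg _) (by norm_num)
  have h3 := norm_le_norm_add_norm_sub' d (gameN.xi θ)
  linarith [norm_nonneg (gameN.xi θ)]

theorem nearXi_la (h : SmallRates ρ α γ) :
    NearXi θ (Algorithm.la.direction gameN α γ prev θ) := by
  refine nearXi_of_rot (c := α) (by rw [abs_of_pos h.pos]; linarith [h.le]) ?_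
  simp only [Algorithm.direction]
  rw [sub_mulVec, one_mulVec, smul_mulVec, hessOff_mulVec]

theorem nearXi_lola (h : SmallRates ρ α γ) :
    NearXi θ (Algorithm.lola.direction gameN α γ prev θ) := by
  refine nearXi_of_rot (c := α + α) (by rw [abs_of_pos (add_pos h.pos h.pos)]; linarith [h.le]) ?_
  simp only [Algorithm.direction]
  rw [sub_mulVec, one_mulVec, smul_mulVec, hessOff_mulVec, chi_eq_rot, sub_sub, add_smul]

theorem nearXi_sos (h : SmallRates ρ α γ) {p : (Fin 2 → ℝ) → ℝ}
    (hp : ∀ θ, p θ ∈ Set.Icc (0 : ℝ) 1) :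
    NearXi θ ((Algorithm.sos p hp).direction gameN α γ prev θ) := by
  have h0 : 0 ≤ p θ * α := mul_nonneg (hp θ).1 h.pos.le
  have h1 : p θ * α ≤ α := mul_le_of_le_one_left h.pos.le (hp θ).2
  refine nearXi_of_rot (c := α + p θ * α) ?_ ?_
  · rw [abs_of_nonneg (add_nonneg h.pos.le h0)]
    linarith [h.le]
  · simp only [Algorithm.direction]
    rw [sub_mulVec, one_mulVec, smul_mulVec, hessOff_mulVec, chi_eq_rot, sub_sub, add_smul]

theorem nearXi_direction (h : SmallRates ρ α γ) (hθ : ‖θ‖ ≤ ρ) {F : Algorithm (Fin 2)}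
    (hF : F = Algorithm.omd → ‖prev‖ ≤ ρ ∧ ‖θ - prev‖ ≤ 2 * α * ‖gameN.xi θ‖) :
    NearXi θ (F.direction gameN α γ prev θ) := by
  cases F with
  | gd =>
    refine NearXi.of_norm_sub_le ?_
    simp only [Algorithm.direction, sub_self, norm_zero]
    positivity
  | agd => exact nearXi_agd h
  | eg => exact nearXi_eg h hθ
  | omd =>
    exact NearXi.of_norm_sub_le ((norm_omd_direction_sub_le h hθ (hF rfl).1 (hF rfl).2).trans
      (by linarith [norm_nonneg (gameN.xi θ)]))
  | omdProx => exact nearXi_omdProx h hθ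
  | sga => exact nearXi_sga
  | co => exact nearXi_co h hθ
  | cgd => exact nearXi_cgd h
  | la => exact nearXi_la h
  | lola => exact nearXi_lola h
  | sos p hp => exact nearXi_sos h hp

theorem stepDefined (h : SmallRates ρ α γ) (hθ : ‖θ‖ ≤ ρ) (F : Algorithm (Fin 2)) :
    F.StepDefined gameN α θ := by
  cases F with
  | omdProx =>
    obtain ⟨η, hη, -⟩ := h.exists_tendsto_prox hθ
    exact ⟨η, hη⟩
  | cgd => exact isUnit_one_add_hessOff α θ
  | _ => trivial

/-! ### Iterates and conclusion -/

/-- Truncated subtraction at `k = 0` encodes the convention `θ₋₁ = θ₀`. -/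
theorem iterates_succ (F : Algorithm (Fin 2)) (θ₀ : Fin 2 → ℝ) (k : ℕ) :
    F.iterates gameN α γ θ₀ (k + 1) = F.iterates gameN α γ θ₀ k -
      α • F.direction gameN α γ (F.iterates gameN α γ θ₀ (k - 1)) (F.iterates gameN α γ θ₀ k) := by
  cases k <;> rfl

theorem norm_le_of_sq_le (hρ : 0 ≤ ρ) (h : θ 0 ^ 2 + θ 1 ^ 2 ≤ ρ ^ 2) : ‖θ‖ ≤ ρ :=
  le_of_sq_le_sq ((sq_norm_le θ).trans h) hρ

/-- As long as the iterates stay in the disc of radius `ρ`, they move by small steps. -/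
theorem planeStep_iterates (h : SmallRates ρ α γ) (F : Algorithm (Fin 2)) (θ₀ : Fin 2 → ℝ)
    (k : ℕ) (hk : ∀ j ≤ k, ‖F.iterates gameN α γ θ₀ j‖ ≤ ρ) :
    ∃ l, PlaneStep α l (F.iterates gameN α γ θ₀ k 0) (F.iterates gameN α γ θ₀ k 1)
      (F.iterates gameN α γ θ₀ (k + 1) 0) (F.iterates gameN α γ θ₀ (k + 1) 1) := by
  rw [iterates_succ]
  refine (nearXi_direction h (hk k le_rfl) ?_).planeStep α
  rintro rfl
  refine ⟨hk _ (by omega), ?_⟩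
  -- The bound on the displacement of OMD holds trivially at the start, where it is zero, and then
  -- propagates.
  induction k with
  | zero =>
    simp only [Nat.zero_sub, sub_self, norm_zero]
    have := h.pos
    positivity
  | succ k ih =>
    exact omd_displacement_le h (hk k (by omega)) (hk _ (by omega))
      (ih fun j hj => hk j (by omega)) (hk _ le_rfl) (iterates_succ _ θ₀ k)

/-- From every initial point in the disc other than the origin, the iterates are well defined,
bounded and do not converge. -/
theorem iterates_defined_bounded_not_tendsto (h : SmallRates ρ α γ)
    (hα : α * (5 * (2 * ρ ^ 2 + (ρ ^ 2) ^ 3) + ρ ^ 2) ≤ 1 / 10) (F : Algorithm (Fin 2))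
    {θ₀ : Fin 2 → ℝ} (h0 : θ₀ ≠ 0) (hθ₀ : θ₀ 0 ^ 2 + θ₀ 1 ^ 2 ≤ ρ ^ 2) :
    (∀ k, F.StepDefined gameN α (F.iterates gameN α γ θ₀ k)) ∧
      Bornology.IsBounded (Set.range (F.iterates gameN α γ θ₀)) ∧
      ¬ ∃ l, Tendsto (F.iterates gameN α γ θ₀) atTop (𝓝 l) := by
  have hρ : 0 ≤ ρ := by linarith [h.radius]
  have hB : 64 ≤ ρ ^ 2 := by nlinarith [h.radius]
  have hsq := sq_le_and_sq_pos_of_planeStep (z := F.iterates gameN α γ θ₀) hB h.pos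
    (by linarith [h.le]) hα h0 hθ₀ fun k hk =>
      planeStep_iterates h F θ₀ k fun j hj => norm_le_of_sq_le hρ (hk j hj)
  have hnorm (k : ℕ) : ‖F.iterates gameN α γ θ₀ k‖ ≤ ρ := norm_le_of_sq_le hρ (hsq k).1
  refine ⟨fun k => stepDefined h (hnorm k) F, ?_, ?_⟩
  · exact isBounded_iff_forall_norm_le.2 ⟨ρ, Set.forall_mem_range.2 hnorm⟩
  · exact not_tendsto_of_planeStep h.pos (fun k => (hsq k).2)
      fun k => planeStep_iterates h F θ₀ k fun j _ => hnorm j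

/-- All sufficiently small rates are admissible for a given radius. -/
theorem exists_smallRates (hρ : 8 ≤ ρ) : ∃ δ : ℝ, 0 < δ ∧ ∀ α γ : ℝ, 0 < α → α < δ → 0 < γ →
    γ < δ → SmallRates ρ α γ ∧ α * (5 * (2 * ρ ^ 2 + (ρ ^ 2) ^ 3) + ρ ^ 2) ≤ 1 / 10 := by
  set K := (2 + 3 * (ρ + 1) ^ 2) * (ρ + 1) with hK
  set M := 5 * (2 * ρ ^ 2 + (ρ ^ 2) ^ 3) + ρ ^ 2 with hM
  have hK0 : 0 < K := by positivity
  have hM0 : 0 < M := by positivity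
  refine ⟨(64 * K + 10 * M)⁻¹, by positivity, fun α γ hα hαδ hγ hγδ => ?_⟩
  have key {β : ℝ} (hβ : 0 < β) (hβδ : β < (64 * K + 10 * M)⁻¹) :
      β * K ≤ 1 / 64 ∧ β * M ≤ 1 / 10 := by
    have h1 := mul_lt_mul_of_pos_right hβδ (by positivity : 0 < 64 * K + 10 * M)
    rw [inv_mul_cancel₀ (by positivity)] at h1
    have h2 := mul_pos hβ hK0
    have h3 := mul_pos hβ hM0
    constructor <;> linarith
  exact ⟨⟨hρ, hα, hγ, (key hα hαδ).1, (key hγ hγδ).1⟩, (key hα hαδ).2⟩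

end gameN

end

theorem theorem3 :
    (gameN.ZeroSum ∧ gameN.WeaklyCoercive ∧ gameN.Nondegenerate ∧ gameN.Analytic) ∧
    (∃ c : Fin 2 → ℝ, gameN.IsStrictMax c ∧ ∀ θ, gameN.IsCritical θ → θ = c) ∧
    ∀ U : Set (Fin 2 → ℝ), Bornology.IsBounded U →
      ∃ δ : ℝ, 0 < δ ∧ ∀ α γ : ℝ, 0 < α → α < δ → 0 < γ → γ < δ →
        ∀ F : Algorithm (Fin 2),
          ∀ ν : Measure (Fin 2 → ℝ), IsProbabilityMeasure ν → (∀ θ, ν {θ} = 0) → ν Uᶜ = 0 →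
            ∀ᵐ θ₀ ∂ν,
              (∀ k, F.StepDefined gameN α (F.iterates gameN α γ θ₀ k)) ∧
              Bornology.IsBounded (Set.range (F.iterates gameN α γ θ₀)) ∧
              ¬ ∃ l, Tendsto (F.iterates gameN α γ θ₀) atTop (𝓝 l) := by
  refine ⟨⟨gameN.zeroSum, gameN.weaklyCoercive, gameN.nondegenerate, gameN.analytic⟩,
    ⟨0, gameN.isStrictMax_zero, fun _ => gameN.eq_zero_of_isCritical⟩, fun U hU => ?_⟩
  obtain ⟨s, hs⟩ := isBounded_iff_forall_norm_le.1 hU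
  -- The radius `8 + 2|s|` passes from the sup norm to the Euclidean disc: `2 s² ≤ (8 + 2|s|)²`.
  have hρ : (8 : ℝ) ≤ 8 + 2 * |s| := by linarith [abs_nonneg s]
  obtain ⟨δ, hδ, hrates⟩ := gameN.exists_smallRates hρ
  refine ⟨δ, hδ, fun α γ hα hαδ hγ hγδ F ν _ hν hνU => ?_⟩
  obtain ⟨hsmall, hαM⟩ := hrates α γ hα hαδ hγ hγδ
  have hne : ∀ᵐ θ₀ ∂ν, θ₀ ≠ 0 := measure_eq_zero_iff_ae_notMem.1 (hν 0)
  have hmem : ∀ᵐ θ₀ ∂ν, θ₀ ∈ U := hνU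
  filter_upwards [hne, hmem] with θ₀ h0 hθ₀
  refine gameN.iterates_defined_bounded_not_tendsto hsmall hαM F h0 ?_
  have hcoord (i : Fin 2) : θ₀ i ^ 2 ≤ s ^ 2 :=
    sq_le_sq.2 (((gameN.abs_coord_le θ₀ i).trans (hs θ₀ hθ₀)).trans (le_abs_self s))
  nlinarith [hcoord 0, hcoord 1, abs_nonneg s, sq_abs s]
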